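/- Let $R$ be an associative ring with identity; all modules are unital. Assume that $R$ is semiprimary (its Jacobson radical $J(R)$ is nilpotent and $R/J(R)$ is semisimple artinian), right hereditary (submodules of projective right $R$-modules are projective) and left coherent (every finitely generated left ideal is finitely presented). For right $R$-modules $M$ and $N$, say that $M$ is $N$-subprojective if for every epimorphism $g\colon B\to N$ of right $R$-modules and every homomorphism $f\colon M\to N$ there is a homomorphism $h\colon M\to B$ with $gh=f$; say that $M$ is strongly soc-projective if $M$ is $N$-subprojective for every semisimple right $R$-module $N$. Then a right $R$-module $M$ is projective if and only if it is strongly soc-projective. -/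

import Mathlib

universe u v w

/-! Right `R`-modules are modules over the opposite ring `Rᵐᵒᵖ`; `Module R`, `Ideal R` refer to
left modules and left ideals. -/

/-- `R` is right hereditary: submodules of projective right `R`-modules are projective.
The universe `w` allows modules to live in a larger universe than `R`. -/
def IsRightHereditary (R : Type u) [Ring R] : Prop :=
  ∀ (P : Type (max u w)) [AddCommGroup P] [Module Rᵐᵒᵖ P],
    Module.Projective Rᵐᵒᵖ P → ∀ K : Submodule Rᵐᵒᵖ P, Module.Projective Rᵐᵒᵖ K

/-- `R` is left coherent: every finitely generated left ideal is finitely presented. -/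
def IsLeftCoherent (R : Type u) [Ring R] : Prop :=
  ∀ I : Ideal R, I.FG → Module.FinitePresentation R I

/-- The right `R`-module `M` is `N`-subprojective: every homomorphism `f : M → N` lifts through
every epimorphism `g : B → N` of right `R`-modules. -/
def IsSubprojective (R : Type u) [Ring R] (M : Type v) [AddCommGroup M] [Module Rᵐᵒᵖ M]
    (N : Type w) [AddCommGroup N] [Module Rᵐᵒᵖ N] : Prop :=
  ∀ (B : Type (max u w)) [AddCommGroup B] [Module Rᵐᵒᵖ B] (g : B →ₗ[Rᵐᵒᵖ] N),
    Function.Surjective g →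
      ∀ f : M →ₗ[Rᵐᵒᵖ] N, ∃ h : M →ₗ[Rᵐᵒᵖ] B, g ∘ₗ h = f

/-- The right `R`-module `M` is strongly soc-projective: it is `N`-subprojective for every
semisimple right `R`-module `N`. -/
def IsStronglySocProjective (R : Type u) [Ring R]
    (M : Type v) [AddCommGroup M] [Module Rᵐᵒᵖ M] : Prop :=
  ∀ (N : Type (max u v)) [AddCommGroup N] [Module Rᵐᵒᵖ N],
    IsSemisimpleModule Rᵐᵒᵖ N → IsSubprojective R M N

open Submodule

/-! Let `J` be the radical, `M` strongly soc-projective and `p : F → M` a surjection with `F` free.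
As `M/MJ` is semisimple, `M → M/MJ` lifts through `F → M → M/MJ` to some `h : M → F`. Then `ph - 1`
maps `M` into `MJ`, so it is nilpotent because `J` is; hence `ph` is invertible and `M` is a direct
summand of `F`. -/

/-- Modulo the kernel of a surjection onto a semisimple ring, every module is semisimple. -/
theorem isSemisimpleModule_quotient_ker_smul_top {S : Type*} {T : Type*} [Ring S] [Ring T]
    [IsSemisimpleRing T] (φ : S →+* T) (hφ : Function.Surjective φ)
    (M : Type*) [AddCommGroup M] [Module S M] :
    IsSemisimpleModule S (M ⧸ RingHom.ker φ • (⊤ : Submodule S M)) := by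
  have : IsSemisimpleRing (S ⧸ RingHom.ker φ) :=
    (RingHom.quotientKerEquivOfSurjective hφ).symm.isSemisimpleRing
  have ht : Module.IsTorsionBySet S (M ⧸ RingHom.ker φ • (⊤ : Submodule S M)) (RingHom.ker φ) := by
    rintro x ⟨a, ha⟩
    obtain ⟨m, rfl⟩ := mkQ_surjective _ x
    change a • mkQ _ m = 0
    rw [← map_smul, mkQ_apply, Quotient.mk_eq_zero]
    exact smul_mem_smul ha mem_top
  let _ := ht.module
  exact ht.isSemisimpleModule_iff.mp inferInstance

/-- An endomorphism moving every element into `I • ⊤` is nilpotent when `I` is nilpotent. -/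
theorem isNilpotent_of_range_le_smul_top {S : Type*} [Ring S] {I : Ideal S} (hI : IsNilpotent I)
    {M : Type*} [AddCommGroup M] [Module S M] (e : Module.End S M)
    (he : LinearMap.range e ≤ I • ⊤) : IsNilpotent e := by
  obtain ⟨n, hn⟩ := hI
  have key : ∀ k, LinearMap.range (e ^ k) ≤ I ^ k • ⊤ := by
    intro k
    induction k with
    | zero => simp [Submodule.pow_zero, Ideal.one_eq_top]
    | succ k ih =>
      rw [pow_succ', Module.End.mul_eq_comp, LinearMap.range_comp]
      refine (map_mono ih).trans ?_
      -- By linearity, `e (I ^ k M) = I ^ k e(M) ≤ I ^ k (I M)`.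
      rw [map_smul'', Submodule.pow_succ, Submodule.mul_smul, Submodule.map_top]
      exact smul_mono_right _ he
  refine ⟨n, LinearMap.range_eq_bot.mp <| le_bot_iff.mp <| (key n).trans ?_⟩
  simp [hn]

/-- A module `M` is projective as soon as, for some nilpotent ideal `I`, the quotient map
`M → M / IM` lifts through the composite of it with a surjection from a projective module. -/
theorem Module.Projective.of_lift_quotient_smul_top {S : Type*} [Ring S] {I : Ideal S}
    (hI : IsNilpotent I) {M P : Type*} [AddCommGroup M] [Module S M] [AddCommGroup P] [Module S P]
    [Module.Projective S P] (p : P →ₗ[S] M) (h : M →ₗ[S] P)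
    (hh : ∀ m, (I • ⊤ : Submodule S M).mkQ (p (h m)) = (I • ⊤ : Submodule S M).mkQ m) :
    Module.Projective S M := by
  have hnil : IsNilpotent (p ∘ₗ h - LinearMap.id : Module.End S M) := by
    refine isNilpotent_of_range_le_smul_top hI _ ?_
    rintro _ ⟨m, rfl⟩
    exact (Submodule.Quotient.eq _).mp (hh m)
  have hu : IsUnit (p ∘ₗ h : Module.End S M) := by
    simpa [Module.End.one_eq_id] using hnil.isUnit_one_add
  obtain ⟨u, hu⟩ := hu
  refine Module.Projective.of_split (h ∘ₗ (↑u⁻¹ : Module.End S M)) p ?_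
  rw [← LinearMap.comp_assoc, ← hu, ← Module.End.mul_eq_comp, Units.mul_inv,
    Module.End.one_eq_id]

/-- The opposite of a nilpotent two-sided ideal is nilpotent. -/
theorem isNilpotent_ker_op_mk {R : Type*} [Ring R] {J : Ideal R} [J.IsTwoSided]
    (hJ : IsNilpotent J) : IsNilpotent (RingHom.ker (Ideal.Quotient.mk J).op) := by
  obtain ⟨n, hn⟩ := hJ
  have key : ∀ k, ∀ x ∈ RingHom.ker (Ideal.Quotient.mk J).op ^ k, x.unop ∈ J ^ k := by
    intro k
    induction k with
    | zero => simp [Submodule.pow_zero, Ideal.one_eq_top]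
    | succ k ih =>
      intro x hx
      rw [Submodule.pow_succ] at hx
      induction hx using Submodule.mul_induction_on' with
      | mem_mul_mem a ha b hb =>
        -- `unop` reverses products, so the new factor of `J` must be split off on the left.
        rw [Ideal.IsTwoSided.pow_succ, MulOpposite.unop_mul]
        refine Ideal.mul_mem_mul (Ideal.Quotient.eq_zero_iff_mem.mp ?_) (ih a ha)
        exact congrArg MulOpposite.unop (RingHom.mem_ker.mp hb)
      | add a _ b _ ha hb => exact add_mem ha hb
  refine ⟨n, le_bot_iff.mp fun x hx ↦ ?_⟩
  have := key n x hx
  rw [hn] at this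
  exact MulOpposite.unop_injective this

theorem Module.Projective.isStronglySocProjective {R : Type u} [Ring R]
    {M : Type v} [AddCommGroup M] [Module Rᵐᵒᵖ M] (hM : Module.Projective Rᵐᵒᵖ M) :
    IsStronglySocProjective R M :=
  fun _ _ _ _ _ _ _ g hg f ↦ Module.projective_lifting_property g f hg

theorem IsStronglySocProjective.projective {R : Type u} [Ring R] [IsSemiprimaryRing R]
    {M : Type v} [AddCommGroup M] [Module Rᵐᵒᵖ M] (hM : IsStronglySocProjective R M) :
    Module.Projective Rᵐᵒᵖ M := by
  let φ := (Ideal.Quotient.mk (Ring.jacobson R)).op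
  have hφ : Function.Surjective φ := fun x ↦ by
    obtain ⟨r, hr⟩ := Ideal.Quotient.mk_surjective x.unop
    exact ⟨.op r, congrArg MulOpposite.op hr⟩
  let Q := M ⧸ RingHom.ker φ • (⊤ : Submodule Rᵐᵒᵖ M)
  let q : M →ₗ[Rᵐᵒᵖ] Q := mkQ _
  have : IsSemisimpleModule Rᵐᵒᵖ Q := isSemisimpleModule_quotient_ker_smul_top φ hφ M
  -- The test modules live in `Type (max u v)`, while `Q` lives in `Type v`.
  let l : ULift.{max u v} Q ≃ₗ[Rᵐᵒᵖ] Q := ULift.moduleEquiv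
  let p := Finsupp.linearCombination Rᵐᵒᵖ (id : M → M)
  have hp : Function.Surjective p := Finsupp.linearCombination_id_surjective Rᵐᵒᵖ M
  obtain ⟨h, hh⟩ := hM (ULift.{max u v} Q) (IsSemisimpleModule.congr l) (M →₀ Rᵐᵒᵖ)
    (l.symm.toLinearMap ∘ₗ q ∘ₗ p)
    (l.symm.surjective.comp ((mkQ_surjective _).comp hp)) (l.symm.toLinearMap ∘ₗ q)
  refine .of_lift_quotient_smul_top (isNilpotent_ker_op_mk IsSemiprimaryRing.isNilpotent) p h
    fun m ↦ l.symm.injective ?_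
  exact LinearMap.congr_fun hh m

theorem mainTheorem9 (R : Type u) [Ring R]
    (hsemiprimary : IsSemiprimaryRing R)
    (hhereditary : IsRightHereditary.{u, v} R)
    (hcoherent : IsLeftCoherent R)
    (M : Type v) [AddCommGroup M] [Module Rᵐᵒᵖ M] :
    Module.Projective Rᵐᵒᵖ M ↔ IsStronglySocProjective R M :=
  ⟨fun h ↦ h.isStronglySocProjective, fun h ↦ h.projective⟩
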